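/- Let $\mathfrak H$ be a complex Hilbert space and let $B$ be a Hermitian contraction in $\mathfrak H$ defined on a subspace $\mathfrak H_0=\operatorname{dom} B\subset\mathfrak H$, i.e. $B:\mathfrak H_0\to\mathfrak H$ is linear, $(Bf,g)=(f,Bg)$ for all $f,g\in\mathfrak H_0$, and $\|B\|\le 1$; put $\mathfrak N=\mathfrak H\ominus\mathfrak H_0$. An $sc$-extension of $B$ is a bounded selfadjoint operator $\widetilde B$ on $\mathfrak H$ with $\|\widetilde B\|\le 1$ and $\widetilde B f=Bf$ for all $f\in\mathfrak H_0$. Let $B_\mu$ and $B_M$ denote the smallest and the largest $sc$-extension of $B$ with respect to the usual order of selfadjoint operators (both exist). Assume that $$\dim\mathfrak N=\infty,\qquad \ker(B_M-B_\mu)=\operatorname{dom}B .$$ Then there exists a pair $\{\widetilde B_0,\widetilde B_1\}$ of $sc$-extensions of $B$, different from the pair $\{B_\mu,B_M\}$, such that $$\widetilde B_0\le\widetilde B_1,\qquad \ker(\widetilde B_1-\widetilde B_0)=\operatorname{dom}B,$$ $$\operatorname{ran}(\widetilde B_1-\widetilde B_0)^{1/2}\cap\operatorname{ran}(\widetilde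 B_0-B_\mu)^{1/2}=\operatorname{ran}(\widetilde B_1-\widetilde B_0)^{1/2}\cap\operatorname{ran}(B_M-\widetilde B_1)^{1/2}=\{0\}.$$ -/

import Mathlib

open scoped InnerProductSpace

/-- A (possibly only partially defined) linear operator `B` in `H` is a Hermitian contraction if
`(Bf, g) = (f, Bg)` and `‖Bf‖ ≤ ‖f‖` for all `f, g ∈ dom B`. -/
structure IsHermitianContraction {H : Type*} [NormedAddCommGroup H] [InnerProductSpace ℂ H]
    (B : H →ₗ.[ℂ] H) : Prop where
  symm : ∀ f g : B.domain, ⟪B f, (g : H)⟫_ℂ = ⟪(f : H), B g⟫_ℂ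
  norm_le : ∀ f : B.domain, ‖B f‖ ≤ ‖(f : H)‖

/-- The set of all selfadjoint contractive (`sc`-) extensions of `B` in `H`: everywhere defined
bounded selfadjoint operators `T` with `‖T‖ ≤ 1` that coincide with `B` on `dom B`. -/
def scExtensions {H : Type*} [NormedAddCommGroup H] [InnerProductSpace ℂ H] [CompleteSpace H]
    (B : H →ₗ.[ℂ] H) : Set (H →L[ℂ] H) :=
  {T | IsSelfAdjoint T ∧ ‖T‖ ≤ 1 ∧ ∀ f : B.domain, T f = B f}

/-- Auxiliary: a nonnegative partially defined operator `A : V → H` (with `ι` the inclusion of its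
domain) with `‖A f‖² ≤ 2 (A f, f)` extends to `J J†` with `J : K → H` bounded, `K` being the
completion of the domain with respect to `(A f, g)`. -/
theorem exists_factor_of_nonneg {H : Type*} [NormedAddCommGroup H] [InnerProductSpace ℂ H]
    [CompleteSpace H] {V : Type*} [AddCommGroup V] [Module ℂ V] (ι A : V →ₗ[ℂ] H)
    (hsym : ∀ x y, ⟪A x, ι y⟫_ℂ = ⟪ι x, A y⟫_ℂ)
    (hbd : ∀ x, ‖A x‖ ^ 2 ≤ 2 * (⟪ι x, A x⟫_ℂ).re) :
    ∃ T : H →L[ℂ] H, IsSelfAdjoint T ∧ ‖T - 1‖ ≤ 1 ∧ (∀ x, T (ι x) = A x) ∧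
      ∀ P : H →L[ℂ] H, 0 ≤ P → (∀ x, P (ι x) = A x) → T ≤ P := by
  let core : PreInnerProductSpace.Core ℂ V :=
    { inner := fun x y => ⟪ι x, A y⟫_ℂ
      conj_inner_symm := fun x y => by
        change (starRingEnd ℂ) ⟪ι y, A x⟫_ℂ = ⟪ι x, A y⟫_ℂ
        rw [inner_conj_symm, hsym]
      re_inner_nonneg := fun x => by
        change 0 ≤ (⟪ι x, A x⟫_ℂ).re
        nlinarith [hbd x, sq_nonneg ‖A x‖]
      add_left := fun x y z => by
        change ⟪ι (x + y), A z⟫_ℂ = ⟪ι x, A z⟫_ℂ + ⟪ι y, A z⟫_ℂ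
        rw [map_add, inner_add_left]
      smul_left := fun x y r => by
        change ⟪ι (r • x), A y⟫_ℂ = (starRingEnd ℂ) r * ⟪ι x, A y⟫_ℂ
        rw [map_smul, inner_smul_left] }
  let _ : SeminormedAddCommGroup V := @InnerProductSpace.Core.toSeminormedAddCommGroup ℂ V _ _ _ core
  let _ : InnerProductSpace ℂ V := InnerProductSpace.ofCore core
  have hin : ∀ x y : V, ⟪x, y⟫_ℂ = ⟪ι x, A y⟫_ℂ := fun x y => rfl
  have hbd' : ∀ x, ‖A x‖ ≤ √2 * ‖x‖ := fun x => by
    apply le_of_sq_le_sq _ (by positivity)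
    rw [mul_pow, Real.sq_sqrt (by norm_num), ← inner_self_eq_norm_sq (𝕜 := ℂ) x]
    exact hbd x
  let e : V →L[ℂ] UniformSpace.Completion V := UniformSpace.Completion.toComplL
  have he : ∀ x, e x = (x : UniformSpace.Completion V) := fun x => rfl
  have hdense : DenseRange e := UniformSpace.Completion.denseRange_coe
  have hnorm : ∀ x, ‖A x‖ ≤ √2 * ‖(e : V →ₗ[ℂ] UniformSpace.Completion V) x‖ := fun x => by
    have : ‖(e : V →ₗ[ℂ] UniformSpace.Completion V) x‖ = ‖x‖ := UniformSpace.Completion.norm_coe x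
    rw [this]; exact hbd' x
  let J : UniformSpace.Completion V →L[ℂ] H := A.extendOfNorm (e : V →ₗ[ℂ] UniformSpace.Completion V)
  have hJ : ∀ x, J (e x) = A x := fun x => LinearMap.extendOfNorm_eq hdense ⟨√2, hnorm⟩ x
  have hJn : ∀ k, ‖J k‖ ≤ √2 * ‖k‖ :=
    fun k => LinearMap.norm_extendOfNorm_apply_le hdense (√2) hnorm k
  have hJadj : ∀ x, (ContinuousLinearMap.adjoint J) (ι x) = e x := fun x => by
    refine hdense.equalizer (g := fun k => ⟪k, (ContinuousLinearMap.adjoint J) (ι x)⟫_ℂ)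
      (h := fun k => ⟪k, e x⟫_ℂ) (by fun_prop) (by fun_prop) ?_ |> fun h => ext_inner_left ℂ
        (fun k => congrFun h k)
    funext y
    simp only [Function.comp]
    rw [ContinuousLinearMap.adjoint_inner_right, hJ, he, he, UniformSpace.Completion.inner_coe, hin,
      hsym]
  refine ⟨J ∘L ContinuousLinearMap.adjoint J,
    (ContinuousLinearMap.isPositive_self_comp_adjoint J).isSelfAdjoint, ?_, ?_, ?_⟩
  · refine ContinuousLinearMap.opNorm_le_bound _ zero_le_one fun x => ?_
    apply le_of_sq_le_sq _ (by positivity)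
    have h1 : ‖(J ∘L ContinuousLinearMap.adjoint J - 1) x‖ ^ 2 =
        ‖J (ContinuousLinearMap.adjoint J x)‖ ^ 2 - 2 * ‖ContinuousLinearMap.adjoint J x‖ ^ 2
          + ‖x‖ ^ 2 := by
      have : (J ∘L ContinuousLinearMap.adjoint J - 1) x = J (ContinuousLinearMap.adjoint J x) - x :=
        rfl
      rw [this, norm_sub_sq (𝕜 := ℂ), ← ContinuousLinearMap.adjoint_inner_right,
        inner_self_eq_norm_sq]
    have h2 := hJn (ContinuousLinearMap.adjoint J x)
    have h3 : ‖J (ContinuousLinearMap.adjoint J x)‖ ^ 2 ≤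
        2 * ‖ContinuousLinearMap.adjoint J x‖ ^ 2 := by
      have := pow_le_pow_left₀ (norm_nonneg _) h2 2
      rwa [mul_pow, Real.sq_sqrt (by norm_num)] at this
    rw [h1]; nlinarith
  · intro x
    rw [ContinuousLinearMap.comp_apply, hJadj, hJ]
  · intro P hP hPA
    have hPsa : IsSelfAdjoint P := IsSelfAdjoint.of_nonneg hP
    let R := CFC.sqrt P
    have hRsa : IsSelfAdjoint R := IsSelfAdjoint.of_nonneg (CFC.sqrt_nonneg P)
    have hRR : ∀ x, R (R x) = P x := fun x => by
      have := CFC.sqrt_mul_sqrt_self P hP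
      exact DFunLike.congr_fun this x
    have hRin : ∀ x y, ⟪x, P y⟫_ℂ = ⟪R x, R y⟫_ℂ := fun x y => by
      rw [← hRR]
      exact (hRsa.isSymmetric x (R y)).symm
    have hRe : ∀ x, ‖R (ι x)‖ = ‖e x‖ := fun x => by
      rw [← sq_eq_sq₀ (norm_nonneg _) (norm_nonneg _), ← inner_self_eq_norm_sq (𝕜 := ℂ), ← hRin, hPA,
        ← hin, inner_self_eq_norm_sq, he, UniformSpace.Completion.norm_coe]
    have hb : ∀ f k, ‖⟪ContinuousLinearMap.adjoint J f, k⟫_ℂ‖ ≤ ‖R f‖ * ‖k‖ := fun f k => by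
      refine hdense.induction_on (p := fun k => ‖⟪ContinuousLinearMap.adjoint J f, k⟫_ℂ‖
        ≤ ‖R f‖ * ‖k‖) k (isClosed_le (by fun_prop) (by fun_prop)) fun x => ?_
      rw [ContinuousLinearMap.adjoint_inner_left, hJ, ← hPA, hRin, ← hRe]
      exact norm_inner_le_norm _ _
    have hc : ∀ f, ‖ContinuousLinearMap.adjoint J f‖ ≤ ‖R f‖ := fun f => by
      have := hb f (ContinuousLinearMap.adjoint J f)
      rw [inner_self_eq_norm_sq_to_K, norm_pow, RCLike.norm_ofReal, abs_norm, sq] at this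
      rcases (norm_nonneg (ContinuousLinearMap.adjoint J f)).eq_or_lt with h | h
      · rw [← h]; exact norm_nonneg _
      · exact le_of_mul_le_mul_right this h
    rw [ContinuousLinearMap.le_def, ContinuousLinearMap.isPositive_def']
    refine ⟨hPsa.sub (ContinuousLinearMap.isPositive_self_comp_adjoint J).isSelfAdjoint, fun x => ?_⟩
    rw [ContinuousLinearMap.reApplyInnerSelf_apply, sub_apply, inner_sub_left,
      map_sub, sub_nonneg, ContinuousLinearMap.comp_apply,
      ← ContinuousLinearMap.adjoint_inner_right, inner_self_eq_norm_sq, inner_re_symm, hRin,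
      inner_self_eq_norm_sq]
    exact pow_le_pow_left₀ (norm_nonneg _) (hc x) 2

/-- For a selfadjoint contraction `T`, `1 + T` is nonnegative. -/
theorem one_add_nonneg_of_norm_le_one {H : Type*} [NormedAddCommGroup H] [InnerProductSpace ℂ H]
    [CompleteSpace H] {T : H →L[ℂ] H} (hT : IsSelfAdjoint T) (hn : ‖T‖ ≤ 1) : 0 ≤ 1 + T := by
  rw [ContinuousLinearMap.nonneg_iff_isPositive, ContinuousLinearMap.isPositive_def']
  refine ⟨(IsSelfAdjoint.one _).add hT, fun x => ?_⟩
  rw [ContinuousLinearMap.reApplyInnerSelf_apply, add_apply, inner_add_left,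
    map_add, one_apply_eq_self, inner_self_eq_norm_sq]
  have h1 : |RCLike.re ⟪T x, x⟫_ℂ| ≤ ‖T x‖ * ‖x‖ :=
    (RCLike.abs_re_le_norm _).trans (norm_inner_le_norm _ _)
  have h2 : ‖T x‖ ≤ 1 * ‖x‖ := T.le_of_opNorm_le hn x
  nlinarith [abs_le.1 h1, norm_nonneg x]

/-- Every Hermitian contraction has a smallest `sc`-extension. -/
theorem IsHermitianContraction.exists_isLeast {H : Type*} [NormedAddCommGroup H]
    [InnerProductSpace ℂ H] [CompleteSpace H] {B : H →ₗ.[ℂ] H} (hB : IsHermitianContraction B) :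
    ∃ T, IsLeast (scExtensions B) T := by
  obtain ⟨T, hsa, hn, hext, hmin⟩ := exists_factor_of_nonneg B.domain.subtype
    (B.domain.subtype + B.toFun) (fun x y => by
      have := hB.symm x y
      simp only [LinearMap.add_apply, Submodule.subtype_apply, inner_add_left, inner_add_right]
      congr 1) (fun x => by
      have h1 := hB.norm_le x
      have h2 : ‖(x : H) + B x‖ ^ 2 = _ := norm_add_sq (𝕜 := ℂ) (x : H) (B x)
      have h3 : RCLike.re ⟪(x : H), (x : H)⟫_ℂ = ‖(x : H)‖ ^ 2 := inner_self_eq_norm_sq _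
      simp only [LinearMap.add_apply, Submodule.subtype_apply, inner_add_right, Complex.add_re]
      simp only [RCLike.re_to_complex] at h2 h3
      have h4 := pow_le_pow_left₀ (norm_nonneg _) h1 2
      change ‖(x : H) + B x‖ ^ 2 ≤ 2 * ((⟪(x : H), (x : H)⟫_ℂ).re + (⟪(x : H), B x⟫_ℂ).re)
      linarith)
  refine ⟨T - 1, ⟨hsa.sub (IsSelfAdjoint.one _), hn, fun f => ?_⟩, fun S hS => ?_⟩
  · have := hext f
    simp only [LinearMap.add_apply, Submodule.subtype_apply] at this
    rw [sub_apply, this, one_apply_eq_self,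
      add_sub_cancel_left]
    rfl
  · have := hmin (1 + S) (one_add_nonneg_of_norm_le_one hS.1 hS.2.1) (fun x => by
      have h := hS.2.2 x
      simp only [Submodule.subtype_apply, add_apply,
        one_apply_eq_self, LinearMap.add_apply, h]
      rfl)
    rwa [sub_le_iff_le_add']

/-- Every Hermitian contraction has a largest `sc`-extension. -/
theorem IsHermitianContraction.exists_isGreatest {H : Type*} [NormedAddCommGroup H]
    [InnerProductSpace ℂ H] [CompleteSpace H] {B : H →ₗ.[ℂ] H} (hB : IsHermitianContraction B) :
    ∃ T, IsGreatest (scExtensions B) T := by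
  have hB' : IsHermitianContraction (-B) :=
    ⟨fun f g => by
      have := hB.symm f g
      simpa using! this, fun f => by simpa using! hB.norm_le f⟩
  have hneg : ∀ T, T ∈ scExtensions (-B) ↔ -T ∈ scExtensions B := fun T => by
    refine and_congr ⟨fun h => h.neg, fun h => by simpa using! h.neg⟩ (and_congr (by rw [norm_neg]) (forall_congr' fun f => ?_))
    change T f = -B f ↔ -T f = B f
    rw [neg_eq_iff_eq_neg]
  obtain ⟨T, hT, hmin⟩ := hB'.exists_isLeast
  refine ⟨-T, (hneg T).1 hT, fun S hS => ?_⟩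
  have := hmin ((hneg (-S)).2 (by rwa [neg_neg]))
  rwa [le_neg]

/-- `B_μ`: the left endpoint (smallest element) of the operator interval `[B_μ, B_M]` of all
`sc`-extensions of the Hermitian contraction `B`. -/
noncomputable def leastScExtension {H : Type*} [NormedAddCommGroup H] [InnerProductSpace ℂ H]
    [CompleteSpace H] (B : H →ₗ.[ℂ] H) (hB : IsHermitianContraction B) : H →L[ℂ] H :=
  hB.exists_isLeast.choose

/-- `B_M`: the right endpoint (largest element) of the operator interval `[B_μ, B_M]` of all
`sc`-extensions of the Hermitian contraction `B`. -/
noncomputable def greatestScExtension {H : Type*} [NormedAddCommGroup H] [InnerProductSpace ℂ H]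
    [CompleteSpace H] (B : H →ₗ.[ℂ] H) (hB : IsHermitianContraction B) : H →L[ℂ] H :=
  hB.exists_isGreatest.choose

theorem leastScExtension_isLeast {H : Type*} [NormedAddCommGroup H] [InnerProductSpace ℂ H]
    [CompleteSpace H] (B : H →ₗ.[ℂ] H) (hB : IsHermitianContraction B) :
    IsLeast (scExtensions B) (leastScExtension B hB) :=
  hB.exists_isLeast.choose_spec

theorem greatestScExtension_isGreatest {H : Type*} [NormedAddCommGroup H] [InnerProductSpace ℂ H]
    [CompleteSpace H] (B : H →ₗ.[ℂ] H) (hB : IsHermitianContraction B) :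
    IsGreatest (scExtensions B) (greatestScExtension B hB) :=
  hB.exists_isGreatest.choose_spec

/-- The conditions defining a special pair `{B₀, B₁}`: `B₀ ≤ B₁`, `ker (B₁ - B₀) = dom B`, and
`ran (B₁ - B₀)^{1/2}` meets each of `ran (B₀ - B_μ)^{1/2}` and `ran (B_M - B₁)^{1/2}` only in `0`. -/
structure IsSpecialPair {H : Type*} [NormedAddCommGroup H] [InnerProductSpace ℂ H]
    [CompleteSpace H] (B : H →ₗ.[ℂ] H) (hB : IsHermitianContraction B)
    (B₀ B₁ : H →L[ℂ] H) : Prop where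
  le : B₀ ≤ B₁
  ker_eq : LinearMap.ker (B₁ - B₀ : H →L[ℂ] H).toLinearMap = B.domain
  range_inf_left :
    LinearMap.range (CFC.sqrt (B₁ - B₀)).toLinearMap ⊓
      LinearMap.range (CFC.sqrt (B₀ - leastScExtension B hB)).toLinearMap = ⊥
  range_inf_right :
    LinearMap.range (CFC.sqrt (B₁ - B₀)).toLinearMap ⊓
      LinearMap.range (CFC.sqrt (greatestScExtension B hB - B₁)).toLinearMap = ⊥

/-! Put S = (B_M - B_μ)^{1/2}, so that ker S = dom B, and let N = (dom B)ᗮ. Any resolution 1 = PP† +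
QQ† + GG† splits B_M - B_μ into nonnegative summands X = SPP†S, Y = SQQ†S, Z = SGG†S. Take B₀ = B_μ
+ X and B₁ = B_M - Z; then B₁ - B₀ = Y. Since ran (TT†)^{1/2} ⊆ ran T
(`exists_apply_eq_sqrt_self_comp_adjoint`), the range conditions hold as soon as ran Q meets ran P
and ran G trivially modulo ker S = dom B. Injectivity of Q† gives ker Y = dom B, and B₀ ≠ B_μ
because ran P is not contained in dom B.

The resolution (`exists_resolution_of_isometries`) lives on a copy of K ⊕ K inside N, with K = ℓ².
Let s, a be selfadjoint strict contractions on K, a injective, with ran s ∩ ran a = {0}; put c = (1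
- s²)^{1/2}, d = (1 - a²)^{1/2}. With P = diag(d, a), one has 1 - P² = D² on K ⊕ K for D = diag(a,
d). Applying D to the two columns of the unitary rotation [[c, s], [-s, c]] gives F and G with FF† +
GG† = D². Finally Q is F plus the projection onto the complement of K ⊕ K. The pair s, a comes from
`HilbertBasis.exists_disjoint_ranges`. -/

open ContinuousLinearMap (adjoint)

/-! ### Square roots and isometric copies of ℓ². -/

/-- `ran (T T†)^{1/2}` is contained in `ran T`. -/
theorem exists_apply_eq_sqrt_self_comp_adjoint {E H : Type*} [NormedAddCommGroup E] [InnerProductSpace ℂ E]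
    [CompleteSpace E] [NormedAddCommGroup H] [InnerProductSpace ℂ H] [CompleteSpace H]
    (T : E →L[ℂ] H) (u : H) : ∃ k, T k = CFC.sqrt (T ∘L adjoint T) u := by
  have hpos : 0 ≤ T ∘L adjoint T :=
    (ContinuousLinearMap.nonneg_iff_isPositive _).2 (ContinuousLinearMap.isPositive_self_comp_adjoint T)
  set R := CFC.sqrt (T ∘L adjoint T) with hR
  have hRsa : IsSelfAdjoint R := IsSelfAdjoint.of_nonneg (CFC.sqrt_nonneg _)
  have hRR : ∀ x, R (R x) = T (adjoint T x) := fun x =>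
    DFunLike.congr_fun (CFC.sqrt_mul_sqrt_self _ hpos) x
  -- Equal norms let T†x ↦ Rx extend to a contraction D on the closure of ran T†. Then R = D T†, and
  -- taking adjoints, R = T D†.
  have hnorm : ∀ x, ‖R x‖ = ‖adjoint T x‖ := fun x => by
    rw [← sq_eq_sq₀ (norm_nonneg _) (norm_nonneg _), ← inner_self_eq_norm_sq (𝕜 := ℂ),
      ← inner_self_eq_norm_sq (𝕜 := ℂ), ContinuousLinearMap.adjoint_inner_right, ← hRR]
    congr 1
    exact (hRsa.isSymmetric (R x) x).symm
  let W := (LinearMap.range (adjoint T).toLinearMap).topologicalClosure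
  let e : H →ₗ[ℂ] W := (adjoint T).toLinearMap.codRestrict W
    fun x => Submodule.le_topologicalClosure _ ⟨x, rfl⟩
  have : CompleteSpace W := (Submodule.isClosed_topologicalClosure _).completeSpace_coe
  have hdense : DenseRange e := fun y => by
    have := y.2
    change (y : E) ∈ closure _ at this
    rw [closure_subtype]
    refine closure_mono ?_ this
    rintro _ ⟨x, rfl⟩
    exact ⟨e x, ⟨x, rfl⟩, rfl⟩
  have hb : ∀ x, ‖R x‖ ≤ 1 * ‖e x‖ := fun x => by
    rw [one_mul, hnorm]; rfl
  let D : W →L[ℂ] H := R.toLinearMap.extendOfNorm e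
  have hD : ∀ x, D (e x) = R x := fun x => LinearMap.extendOfNorm_eq hdense ⟨1, hb⟩ x
  refine ⟨(adjoint D u : W), ext_inner_right ℂ fun x => ?_⟩
  rw [← ContinuousLinearMap.adjoint_inner_right]
  change ⟪adjoint D u, e x⟫_ℂ = _
  rw [ContinuousLinearMap.adjoint_inner_left, hD]
  exact (hRsa.isSymmetric u x).symm

/-- An infinite-dimensional Hilbert space contains two orthogonal isometric copies of `ℓ²`. -/
theorem exists_orthogonal_isometries {H : Type*} [NormedAddCommGroup H] [InnerProductSpace ℂ H]
    [CompleteSpace H] (N : Submodule ℂ H) [CompleteSpace N] (hN : ¬ FiniteDimensional ℂ N) :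
    ∃ V W : lp (fun _ : ℕ => ℂ) 2 →L[ℂ] H, (∀ x, adjoint V (V x) = x) ∧ (∀ x, adjoint W (W x) = x) ∧
      (∀ x, adjoint V (W x) = 0) ∧ (∀ x, adjoint W (V x) = 0) ∧ (∀ x, V x ∈ N) ∧ ∀ x, W x ∈ N := by
  obtain ⟨w, b, hb⟩ := exists_hilbertBasis ℂ N
  have hinf : Infinite w := by
    by_contra h
    rw [not_infinite_iff_finite] at h
    apply hN
    have := Fintype.ofFinite w
    exact Module.Basis.finiteDimensional_of_finite b.toOrthonormalBasis.toBasis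
  -- The two summands of ℕ ⊕ ℕ select two disjoint sequences from one orthonormal basis.
  let f : ℕ ⊕ ℕ → w := fun i => Infinite.natEmbedding w (Equiv.natSumNatEquivNat i)
  have hf : Function.Injective f :=
    (Infinite.natEmbedding w).injective.comp Equiv.natSumNatEquivNat.injective
  have ho : Orthonormal ℂ (fun i => b (f i)) := b.orthonormal.comp f hf
  have hl : Orthonormal ℂ (fun i => b (f (Sum.inl i))) := ho.comp Sum.inl Sum.inl_injective
  have hr : Orthonormal ℂ (fun i => b (f (Sum.inr i))) := ho.comp Sum.inr Sum.inr_injective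
  let V := hl.orthogonalFamily.linearIsometry
  let W := hr.orthogonalFamily.linearIsometry
  have horth : ∀ x y, ⟪V x, W y⟫_ℂ = 0 := fun x y => by
    have hx := hl.orthogonalFamily.hasSum_linearIsometry x
    have hy := hr.orthogonalFamily.hasSum_linearIsometry y
    have h1 : ∀ i, ⟪W y, b (f (Sum.inl i))⟫_ℂ = 0 := fun i => by
      rw [← inner_conj_symm, map_eq_zero]
      refine (hy.mapL (innerSL ℂ (b (f (Sum.inl i))))).unique ?_
      refine (hasSum_zero).congr_fun ?_
      intro j
      simp [ho.2 (show Sum.inl i ≠ Sum.inr j by simp)]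
    rw [← inner_conj_symm, map_eq_zero]
    refine (hx.mapL (innerSL ℂ (W y))).unique ?_
    refine (hasSum_zero).congr_fun ?_
    intro j
    simp [h1]
  refine ⟨N.subtypeL ∘L V.toContinuousLinearMap, N.subtypeL ∘L W.toContinuousLinearMap,
    fun x => ?_, fun x => ?_, fun x => ?_, fun x => ?_, fun x => (V x).2, fun x => (W x).2⟩
  all_goals
    refine ext_inner_left ℂ fun y => ?_
    rw [ContinuousLinearMap.adjoint_inner_right]
  · exact V.inner_map_map y x
  · exact W.inner_map_map y x
  · rw [inner_zero_right]; exact horth y x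
  · rw [inner_zero_right]; exact inner_eq_zero_symm.1 (horth x y)

/-! ### Operators on ℓ² with disjoint ranges. -/

/-- A symmetric real matrix with absolutely summable entries defines a bounded selfadjoint
operator. -/
theorem HilbertBasis.exists_isSelfAdjoint_of_summable {K : Type*} [NormedAddCommGroup K]
    [InnerProductSpace ℂ K] [CompleteSpace K] (e : HilbertBasis ℕ ℂ K) (m : ℕ → ℕ → ℝ)
    (hsymm : ∀ i j, m i j = m j i) (hm : Summable fun p : ℕ × ℕ => |m p.1 p.2|) :
    ∃ S : K →L[ℂ] K, IsSelfAdjoint S ∧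
      ∀ x n, HasSum (fun k => (m n k : ℂ) * ⟪e k, x⟫_ℂ) ⟪e n, S x⟫_ℂ := by
  have hsum : Summable fun p : ℕ × ℕ =>
      (m p.1 p.2 : ℂ) • InnerProductSpace.rankOne ℂ (e p.1) (e p.2) := by
    refine Summable.of_norm (hm.congr fun p => ?_)
    rw [norm_smul, InnerProductSpace.norm_rankOne, e.orthonormal.1, e.orthonormal.1]
    simp
  refine ⟨∑' p : ℕ × ℕ, (m p.1 p.2 : ℂ) • InnerProductSpace.rankOne ℂ (e p.1) (e p.2), ?_,
    fun x n => ?_⟩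
  · rw [isSelfAdjoint_iff, tsum_star, ← (Equiv.prodComm ℕ ℕ).tsum_eq]
    refine tsum_congr fun p => ?_
    rw [star_smul, ContinuousLinearMap.star_eq_adjoint, InnerProductSpace.adjoint_rankOne]
    simp [hsymm p.1 p.2]
  · have h1 := (hsum.hasSum.mapL (ContinuousLinearMap.apply ℂ K x)).mapL (innerSL ℂ (e n))
    have hinj : Function.Injective fun k : ℕ => (n, k) := fun _ _ h => (Prod.ext_iff.1 h).2
    rw [← hinj.hasSum_iff] at h1
    · refine HasSum.congr_fun h1 fun k => ?_
      simp [e.orthonormal.1]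
    · rintro ⟨i, k⟩ hp
      have : n ≠ i := fun h => hp ⟨k, by rw [h]⟩
      simp [e.orthonormal.2 this]

/-- If the sequence of sums `∑ₖ 2^{-(k+1)(n+1)} ξₖ` decays superexponentially, then `ξ = 0`. -/
theorem eq_zero_of_tendsto_geometric_moments {ξ β : ℕ → ℂ} {M : ℝ} (hξ : ∀ k, ‖ξ k‖ ≤ M)
    (hβ : ∀ n, HasSum (fun k => (((1 / 2 : ℝ) ^ ((k + 1) * (n + 1)) : ℝ) : ℂ) * ξ k) (β n))
    (hlim : ∀ k, Filter.Tendsto (fun n => (2 : ℂ) ^ ((k + 1) * (n + 1)) * β n) Filter.atTop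
      (nhds 0)) (k : ℕ) : ξ k = 0 := by
  induction k using Nat.strong_induction_on with
  | _ k ih =>
  have hM : 0 ≤ M := (norm_nonneg _).trans (hξ 0)
  -- After scaling, term j is 2^{(k-j)(n+1)} ξⱼ: zero for j < k by induction, constant for j = k,
  -- and tending to 0 for j > k. Dominated convergence leaves ξₖ as the limit.
  have hterm : ∀ n j, (2 : ℂ) ^ ((k + 1) * (n + 1)) *
      ((((1 / 2 : ℝ) ^ ((j + 1) * (n + 1)) : ℝ) : ℂ) * ξ j)
      = ((2 ^ k * (1 / 2) ^ j : ℝ) : ℂ) ^ (n + 1) * ξ j := fun n j => by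
    push_cast
    rw [← mul_assoc, pow_mul, pow_mul, ← mul_pow]
    congr 2
    ring
  have h1 : Filter.Tendsto
      (fun n => ∑' j, ((2 ^ k * (1 / 2) ^ j : ℝ) : ℂ) ^ (n + 1) * ξ j) Filter.atTop
      (nhds (∑' j, if j = k then ξ k else 0)) := by
    refine tendsto_tsum_of_dominated_convergence
      (bound := fun j => 2 ^ k * (1 / 2) ^ j * M) ?_ ?_ ?_
    · exact ((summable_geometric_of_lt_one (by norm_num) (by norm_num)).mul_left _).mul_right _
    · intro j
      rcases lt_trichotomy j k with h | h | h
      · simp [ih j h, h.ne]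
      · subst h
        have : (2 ^ j * (1 / 2) ^ j : ℝ) = 1 := by rw [← mul_pow]; norm_num
        rw [this]; simp
      · rw [if_neg h.ne', ← zero_mul (ξ j)]
        refine Filter.Tendsto.mul_const _ ?_
        refine (tendsto_pow_atTop_nhds_zero_of_norm_lt_one ?_).comp (Filter.tendsto_add_atTop_nat 1)
        rw [Complex.norm_real, Real.norm_of_nonneg (by positivity), one_div, inv_pow,
          ← div_eq_mul_inv, div_lt_one (by positivity)]
        exact pow_lt_pow_right₀ (by norm_num) h
    · refine Filter.Eventually.of_forall fun n j => ?_
      rcases lt_or_ge j k with h | h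
      · rw [ih j h, mul_zero, norm_zero]; positivity
      · rw [norm_mul, norm_pow, Complex.norm_real, Real.norm_of_nonneg (by positivity)]
        refine mul_le_mul ?_ (hξ j) (norm_nonneg _) (by positivity)
        refine pow_le_of_le_one (by positivity) ?_ (by simp)
        rw [one_div, inv_pow, ← div_eq_mul_inv, div_le_one (by positivity)]
        exact pow_le_pow_right₀ (by norm_num) h
  rw [tsum_ite_eq] at h1
  refine tendsto_nhds_unique h1 ((hlim k).congr fun n => ?_)
  rw [← ((hβ n).mul_left ((2 : ℂ) ^ ((k + 1) * (n + 1)))).tsum_eq]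
  exact tsum_congr (hterm n)

/-- There are two injective selfadjoint operators on `ℓ²` whose ranges meet only in `0`. -/
theorem HilbertBasis.exists_disjoint_ranges {K : Type*} [NormedAddCommGroup K]
    [InnerProductSpace ℂ K] [CompleteSpace K] (e : HilbertBasis ℕ ℂ K) :
    ∃ s a : K →L[ℂ] K, IsSelfAdjoint s ∧ IsSelfAdjoint a ∧ (∀ x, a x = 0 → x = 0) ∧
      ∀ x y, s x = a y → x = 0 := by
  have hext : ∀ x : K, (∀ n, ⟪e n, x⟫_ℂ = 0) → x = 0 := fun x hx => by
    apply e.repr.injective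
    ext n
    simp [e.repr_apply_apply, hx]
  obtain ⟨s, hs, hs'⟩ := e.exists_isSelfAdjoint_of_summable
    (fun i j => (1 / 2 : ℝ) ^ ((j + 1) * (i + 1))) (fun i j => by rw [mul_comm]) (by
      have hg : Summable fun n : ℕ => (1 / 2 : ℝ) ^ n :=
        summable_geometric_of_lt_one (by norm_num) (by norm_num)
      refine Summable.of_nonneg_of_le (fun _ => abs_nonneg _) (fun p => ?_)
        (hg.mul_of_nonneg hg (fun _ => by positivity) (fun _ => by positivity))
      rw [abs_of_nonneg (by positivity), ← pow_add]
      exact pow_le_pow_of_le_one (by norm_num) (by norm_num) (by nlinarith))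
  obtain ⟨a, ha, ha'⟩ := e.exists_isSelfAdjoint_of_summable
    (fun i j => if i = j then ((i + 1).factorial : ℝ)⁻¹ else 0)
    (fun i j => by
      rcases eq_or_ne i j with h | h
      · simp [h]
      · simp [h, h.symm]) (by
      have hinj : Function.Injective fun k : ℕ => (k, k) := fun _ _ h => (Prod.ext_iff.1 h).2
      rw [← hinj.summable_iff]
      · have := (summable_nat_add_iff 1).2 (Real.summable_pow_div_factorial 1)
        refine this.congr fun n => ?_
        simp
      · rintro ⟨i, j⟩ hp
        have : i ≠ j := fun h => hp ⟨i, by rw [h]⟩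
        simp [this])
  have haco : ∀ x n, ⟪e n, a x⟫_ℂ = ((n + 1).factorial : ℂ)⁻¹ * ⟪e n, x⟫_ℂ := fun x n => by
    refine (ha' x n).unique ?_
    convert hasSum_ite_eq n (((n + 1).factorial : ℂ)⁻¹ * ⟪e n, x⟫_ℂ) using 2 with k
    rcases eq_or_ne n k with h | h
    · simp [h]
    · simp [h, h.symm]
  have hbd : ∀ x n, ‖⟪e n, x⟫_ℂ‖ ≤ ‖x‖ := fun x n => by
    simpa [e.orthonormal.1] using norm_inner_le_norm (𝕜 := ℂ) (e n) x
  refine ⟨s, a, hs, ha, fun x hx => hext x fun n => ?_, fun x y hxy => hext x ?_⟩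
  · have := haco x n
    rw [hx, inner_zero_right] at this
    simpa [Nat.factorial_ne_zero] using this
  -- If s x = a y, the coordinates of s x are O(1/(n+1)!), which beats every 2^{(k+1)(n+1)}.
  · refine eq_zero_of_tendsto_geometric_moments (hbd x) (hs' x) fun k => ?_
    refine squeeze_zero_norm (a := fun n => (2 ^ (k + 1) : ℝ) ^ (n + 1) / (n + 1).factorial * ‖y‖)
      (fun n => ?_) ?_
    · rw [hxy, haco, norm_mul, norm_mul, norm_pow, norm_inv, ← mul_assoc, pow_mul]
      refine mul_le_mul ?_ (hbd y n) (norm_nonneg _) (by positivity)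
      simp [div_eq_mul_inv]
    · rw [← zero_mul ‖y‖]
      exact ((FloorSemiring.tendsto_pow_div_factorial_atTop (2 ^ (k + 1) : ℝ)).comp
        (Filter.tendsto_add_atTop_nat 1)).mul_const _

/-! ### Defect operators, scaling, and the interval of extensions. -/

/-- For a selfadjoint strict contraction `t`, the operator `(1 - t²)^{1/2}` is injective, selfadjoint
and commutes with `t`. -/
theorem exists_selfAdjoint_complement {K : Type*} [NormedAddCommGroup K]
    [InnerProductSpace ℂ K] [CompleteSpace K] {t : K →L[ℂ] K} (ht : IsSelfAdjoint t)
    (hn : ‖t‖ < 1) :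
    ∃ c : K →L[ℂ] K, IsSelfAdjoint c ∧ c * c = 1 - t * t ∧ Commute t c ∧ ∀ x, c x = 0 → x = 0 := by
  have htt : IsSelfAdjoint (t * t) := by
    simp [isSelfAdjoint_iff, star_mul, ht.star_eq]
  have hpos : 0 ≤ 1 - t * t := by
    have : ‖t * t‖ ≤ 1 := (norm_mul_le _ _).trans (by nlinarith [norm_nonneg t])
    rw [sub_eq_add_neg]
    exact one_add_nonneg_of_norm_le_one (IsSelfAdjoint.neg htt) (by rwa [norm_neg])
  have hcc := CFC.sqrt_mul_sqrt_self (1 - t * t) hpos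
  refine ⟨CFC.sqrt (1 - t * t), IsSelfAdjoint.of_nonneg (CFC.sqrt_nonneg _), hcc, ?_,
    fun x hx => ?_⟩
  · rw [CFC.sqrt]
    exact (Commute.cfcₙ_nnreal (a := 1 - t * t) (b := t) (by
      apply Commute.sub_left (Commute.one_left _)
      exact (Commute.refl t).mul_left (Commute.refl t)) NNReal.sqrt).symm
  -- c x = 0 means x = t²x, which forces x = 0 when ‖t‖ < 1.
  · have h1 : x = t (t x) := by
      have := DFunLike.congr_fun hcc x
      simp only [mul_apply_eq_comp, sub_apply, one_apply_eq_self, hx, map_zero] at this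
      exact (sub_eq_zero.1 this.symm)
    have h2 : ‖x‖ ≤ ‖t‖ * (‖t‖ * ‖x‖) := by
      conv_lhs => rw [h1]
      exact (t.le_opNorm _).trans (by gcongr; exact t.le_opNorm _)
    rw [← norm_le_zero_iff]
    by_contra! h
    nlinarith [norm_nonneg t, mul_pos h (sub_pos.2 hn),
      mul_nonneg (norm_nonneg t) (mul_pos h (sub_pos.2 hn)).le]

/-- A selfadjoint operator has a nonzero real multiple of norm less than one. -/
theorem exists_scaled_norm_lt_one {K : Type*} [NormedAddCommGroup K]
    [InnerProductSpace ℂ K] [CompleteSpace K] {t : K →L[ℂ] K} (ht : IsSelfAdjoint t) :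
    ∃ r : ℝ, r ≠ 0 ∧ IsSelfAdjoint ((r : ℂ) • t) ∧ ‖(r : ℂ) • t‖ < 1 := by
  refine ⟨(‖t‖ + 1)⁻¹, by positivity, ?_, ?_⟩
  · rw [isSelfAdjoint_iff, star_smul, ht.star_eq]
    simp
  · rw [norm_smul, Complex.norm_real, Real.norm_of_nonneg (by positivity),
      inv_mul_lt_one₀ (by positivity)]
    linarith

/-- The two operators of `HilbertBasis.exists_disjoint_ranges` can be taken strictly contractive. -/
theorem HilbertBasis.exists_disjoint_ranges_contraction {K : Type*} [NormedAddCommGroup K]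
    [InnerProductSpace ℂ K] [CompleteSpace K] (e : HilbertBasis ℕ ℂ K) :
    ∃ s a : K →L[ℂ] K, IsSelfAdjoint s ∧ ‖s‖ < 1 ∧ IsSelfAdjoint a ∧ ‖a‖ < 1 ∧
      (∀ x, a x = 0 → x = 0) ∧ ∀ x y, s x = a y → x = 0 := by
  obtain ⟨s, a, hs, ha, hinj, hdisj⟩ := e.exists_disjoint_ranges
  obtain ⟨r, hr, hrs, hrn⟩ := exists_scaled_norm_lt_one hs
  obtain ⟨q, hq, hqa, hqn⟩ := exists_scaled_norm_lt_one ha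
  refine ⟨_, _, hrs, hrn, hqa, hqn, fun x hx => hinj x ?_,
    fun x y hxy => hdisj x ((q / r : ℂ) • y) ?_⟩
  · simpa [hq] using hx
  · have hr' : (r : ℂ) ≠ 0 := by exact_mod_cast hr
    simp only [smul_apply] at hxy
    rw [map_smul, div_eq_inv_mul, mul_smul, ← hxy, inv_smul_smul₀ hr']

/-- A selfadjoint extension of `B` between two `sc`-extensions is an `sc`-extension. -/
theorem mem_scExtensions_of_mem_Icc {H : Type*} [NormedAddCommGroup H] [InnerProductSpace ℂ H]
    [CompleteSpace H] {B : H →ₗ.[ℂ] H} {T₀ T₁ T : H →L[ℂ] H} (h₀ : T₀ ∈ scExtensions B)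
    (h₁ : T₁ ∈ scExtensions B) (hT : IsSelfAdjoint T) (h0 : T₀ ≤ T) (h1 : T ≤ T₁)
    (hext : ∀ f : B.domain, T f = B f) : T ∈ scExtensions B := by
  refine ⟨hT, ?_, hext⟩
  -- The sandwich gives -1 ≤ T ≤ 1, and ‖T‖ or -‖T‖ lies in the spectrum of T.
  have hone : ∀ S ∈ scExtensions B, S ≤ 1 ∧ -S ≤ 1 := fun S hS => by
    refine ⟨?_, ?_⟩
    · have := one_add_nonneg_of_norm_le_one hS.1.neg (by rw [norm_neg]; exact hS.2.1)
      rwa [← sub_eq_add_neg, sub_nonneg] at this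
    · have := one_add_nonneg_of_norm_le_one hS.1 hS.2.1
      rwa [← sub_neg_eq_add, sub_nonneg] at this
  have hle : T ≤ 1 := h1.trans (hone _ h₁).1
  have hge : -T ≤ 1 := (neg_le_neg h0).trans (hone _ h₀).2
  rcases subsingleton_or_nontrivial (H →L[ℂ] H) with h | h
  · rw [Subsingleton.elim T 0, norm_zero]; exact zero_le_one
  rcases CStarAlgebra.norm_or_neg_norm_mem_spectrum hT with hs | hs
  · have := (le_algebraMap_iff_spectrum_le (R := ℝ) (r := 1) (a := T) hT).1 (by simpa using hle)
    exact this _ hs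
  · have := (algebraMap_le_iff_le_spectrum (R := ℝ) (r := -1) (a := T) hT).1 (by
      simpa using neg_le.1 hge)
    linarith [this _ hs]

/-! ### The resolution of the identity. -/

/-- Given two orthogonal isometric copies of a separable Hilbert space in `N`, the identity is a
sum `P P† + Q Q† + G G†` in which `Q†` is injective and, even modulo `Nᗮ`, the range of `Q` meets
the ranges of `P` and `G` only in `0`. -/
theorem exists_resolution_of_isometries {H K : Type*} [NormedAddCommGroup H]
    [InnerProductSpace ℂ H] [CompleteSpace H] [NormedAddCommGroup K] [InnerProductSpace ℂ K]
    [CompleteSpace K] (e : HilbertBasis ℕ ℂ K) {N : Submodule ℂ H} {V W : K →L[ℂ] H}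
    (hVV : ∀ x, adjoint V (V x) = x) (hWW : ∀ x, adjoint W (W x) = x)
    (hVW : ∀ x, adjoint V (W x) = 0) (hWV : ∀ x, adjoint W (V x) = 0)
    (hV : ∀ x, V x ∈ N) (hW : ∀ x, W x ∈ N) :
    ∃ (P Q : H →L[ℂ] H) (G : K →L[ℂ] H),
      P ∘L adjoint P + Q ∘L adjoint Q + G ∘L adjoint G = 1 ∧
      (∀ x y, Q x - P y ∈ Nᗮ → P y = 0) ∧ (∀ x y, Q x - G y ∈ Nᗮ → G y = 0) ∧
      (∀ x, adjoint Q x = 0 → x = 0) ∧ ∃ x, P x ∉ Nᗮ := by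
  obtain ⟨s, a, hs, hsn, ha, han, hainj, hsa⟩ := e.exists_disjoint_ranges_contraction
  obtain ⟨c, hc, hcc, hsc, -⟩ := exists_selfAdjoint_complement hs hsn
  obtain ⟨d, hd, hdd, had, hdinj⟩ := exists_selfAdjoint_complement ha han
  replace hcc : ∀ x, c (c x) = x - s (s x) := fun x => DFunLike.congr_fun hcc x
  replace hdd : ∀ x, d (d x) = x - a (a x) := fun x => DFunLike.congr_fun hdd x
  replace hsc : ∀ x, c (s x) = s (c x) := fun x => (DFunLike.congr_fun hsc x).symm
  replace had : ∀ x, d (a x) = a (d x) := fun x => (DFunLike.congr_fun had x).symm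
  replace hs : adjoint s = s := hs
  replace ha : adjoint a = a := ha
  replace hc : adjoint c = c := hc
  replace hd : adjoint d = d := hd
  have hVN : ∀ x ∈ Nᗮ, adjoint V x = 0 := fun x hx => ext_inner_left ℂ fun y => by
    rw [ContinuousLinearMap.adjoint_inner_right, inner_zero_right]; exact hx _ (hV y)
  have hWN : ∀ x ∈ Nᗮ, adjoint W x = 0 := fun x hx => ext_inner_left ℂ fun y => by
    rw [ContinuousLinearMap.adjoint_inner_right, inner_zero_right]; exact hx _ (hW y)
  let P := V ∘L d ∘L adjoint V + W ∘L a ∘L adjoint W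
  let P₀ := 1 - V ∘L adjoint V - W ∘L adjoint W
  let F := V ∘L a ∘L c - W ∘L d ∘L s
  let G := V ∘L a ∘L s + W ∘L d ∘L c
  let Q := F ∘L adjoint V + P₀
  have hP : ∀ x, P x = V (d (adjoint V x)) + W (a (adjoint W x)) := fun x => rfl
  have hG : ∀ x, G x = V (a (s x)) + W (d (c x)) := fun x => rfl
  have hQ : ∀ x, Q x = V (a (c (adjoint V x))) - W (d (s (adjoint V x))) +
    (x - V (adjoint V x) - W (adjoint W x)) := fun x => rfl
  have hPadj : ∀ x, adjoint P x = V (d (adjoint V x)) + W (a (adjoint W x)) := fun x => by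
    simp [P, map_add, ContinuousLinearMap.adjoint_comp, ha, hd]
  have hGadj : ∀ x, adjoint G x = s (a (adjoint V x)) + c (d (adjoint W x)) := fun x => by
    simp [G, map_add, ContinuousLinearMap.adjoint_comp, ha, hd, hs, hc]
  have hone : adjoint (1 : H →L[ℂ] H) = 1 := star_one _
  have hQadj : ∀ x, adjoint Q x = V (c (a (adjoint V x)) - s (d (adjoint W x))) +
      (x - V (adjoint V x) - W (adjoint W x)) := fun x => by
    simp [Q, F, P₀, map_add, map_sub, ContinuousLinearMap.adjoint_comp, ha, hd, hs, hc, hone]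
  have hVQ : ∀ x, adjoint V (Q x) = a (c (adjoint V x)) := fun x => by
    simp [hQ, hVV, hVW]
  have hWQ : ∀ x, adjoint W (Q x) = - d (s (adjoint V x)) := fun x => by
    simp [hQ, hWW, hWV]
  have hVP : ∀ x, adjoint V (P x) = d (adjoint V x) := fun x => by
    simp [hP, hVV, hVW]
  have hWP : ∀ x, adjoint W (P x) = a (adjoint W x) := fun x => by
    simp [hP, hWW, hWV]
  have hVG : ∀ x, adjoint V (G x) = a (s x) := fun x => by
    simp [hG, hVV, hVW]
  have hWG : ∀ x, adjoint W (G x) = d (c x) := fun x => by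
    simp [hG, hWW, hWV]
  refine ⟨P, Q, G, ?_, fun x y h => ?_, fun x y h => ?_, fun x h => ?_, ?_⟩
  · ext x
    change P (adjoint P x) + Q (adjoint Q x) + G (adjoint G x) = x
    rw [hPadj, hQadj, hGadj, hP, hQ, hG]
    simp only [map_add, map_sub, map_zero, hVV, hWW, hVW, hWV, add_zero, zero_add, sub_self,
      sub_zero, hcc, hdd, hsc]
    abel
  · have h1 := hVN _ h
    have h2 := hWN _ h
    rw [map_sub, hVQ, hVP, sub_eq_zero] at h1
    rw [map_sub, hWQ, hWP, sub_eq_zero] at h2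
    -- With u = V†x and w = W†y, applying d to -d s u = a w and using d² = 1 - a² gives s u = a(a s
    -- u - d w), so u = 0 by disjointness of ranges.
    have h3 : adjoint V x = 0 := by
      refine hsa _ (a (s (adjoint V x)) - d (adjoint W y)) ?_
      rw [map_sub, ← had, ← h2, map_neg, hdd]
      abel
    rw [h3, map_zero, map_zero] at h1
    rw [h3, map_zero, map_zero, neg_zero] at h2
    rw [hP, ← h1, ← h2, map_zero, map_zero, add_zero]
  · have h1 := hVN _ h
    have h2 := hWN _ h
    rw [map_sub, hVQ, hVG, ← map_sub] at h1
    rw [map_sub, hWQ, hWG, ← map_neg, ← map_sub] at h2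
    have h3 := sub_eq_zero.1 (hainj _ h1)
    have h4 := sub_eq_zero.1 (hdinj _ h2)
    -- Cancelling a and d leaves c u = s y and -s u = c y for u = V†x, so y = s²y + c²y = s c u - c
    -- s u = 0.
    have h5 : y = s (s y) + c (c y) := by rw [hcc]; abel
    rw [← h3, ← h4, map_neg, hsc, add_neg_cancel] at h5
    rw [h5, map_zero]
  · have h1 := congrArg (adjoint V) h
    rw [hQadj, map_add, hVV, map_sub, map_sub, hVV, hVW, map_zero, sub_self, sub_zero, add_zero,
      sub_eq_zero] at h1
    -- For v = V†x, w = W†x, the vector z = s a v + c d w satisfies s z = a v and c z = d w.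
    -- Disjoint ranges force z = 0, hence v = w = 0.
    have h2 : s (s (a (adjoint V x)) + c (d (adjoint W x))) = a (adjoint V x) := by
      rw [map_add, ← hsc, ← h1, hcc]; abel
    have h3 := hsa _ _ h2
    rw [h3, map_zero] at h2
    have h4 : c (s (a (adjoint V x)) + c (d (adjoint W x))) = d (adjoint W x) := by
      rw [map_add, hsc, h1, hcc]; abel
    rw [h3, map_zero] at h4
    have h5 := hainj _ h2.symm
    have h6 := hdinj _ h4.symm
    rw [hQadj, h5, h6] at h
    simpa using h
  -- V† P V = d is injective, so any nonzero vector of K would serve.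
  · refine ⟨V (e 0), fun h => ?_⟩
    have h1 := hVN _ h
    rw [hVP, hVV] at h1
    have h2 := e.orthonormal.1 0
    rw [hdinj _ h1, norm_zero] at h2
    exact zero_ne_one h2

/-- The resolution of `exists_resolution_of_isometries` exists for every closed
infinite-dimensional subspace `N`. -/
theorem exists_resolution {H : Type*} [NormedAddCommGroup H] [InnerProductSpace ℂ H]
    [CompleteSpace H] (N : Submodule ℂ H) [CompleteSpace N] (hN : ¬ FiniteDimensional ℂ N) :
    ∃ (P Q : H →L[ℂ] H) (G : lp (fun _ : ℕ => ℂ) 2 →L[ℂ] H),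
      P ∘L adjoint P + Q ∘L adjoint Q + G ∘L adjoint G = 1 ∧
      (∀ x y, Q x - P y ∈ Nᗮ → P y = 0) ∧ (∀ x y, Q x - G y ∈ Nᗮ → G y = 0) ∧
      (∀ x, adjoint Q x = 0 → x = 0) ∧ ∃ x, P x ∉ Nᗮ := by
  obtain ⟨V, W, hVV, hWW, hVW, hWV, hV, hW⟩ := exists_orthogonal_isometries N hN
  exact exists_resolution_of_isometries ⟨LinearIsometryEquiv.refl ℂ _⟩ hVV hWW hVW hWV hV hW

/-- `ker T T† ⊆ ker T†`. -/
theorem adjoint_apply_eq_zero_of_self_comp_adjoint {E H : Type*} [NormedAddCommGroup E] [InnerProductSpace ℂ E]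
    [CompleteSpace E] [NormedAddCommGroup H] [InnerProductSpace ℂ H] [CompleteSpace H]
    {T : E →L[ℂ] H} {x : H} (h : T (adjoint T x) = 0) : adjoint T x = 0 := by
  rw [← inner_self_eq_zero (𝕜 := ℂ), ContinuousLinearMap.adjoint_inner_right, h, inner_zero_left]

/-! ### The special pair. -/

theorem corollary4p1 {H : Type*} [NormedAddCommGroup H] [InnerProductSpace ℂ H] [CompleteSpace H]
    (B : H →ₗ.[ℂ] H) (hB : IsHermitianContraction B)
    (hdim : ¬ FiniteDimensional ℂ (B.domainᗮ : Submodule ℂ H))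
    (hker : LinearMap.ker
      (greatestScExtension B hB - leastScExtension B hB : H →L[ℂ] H).toLinearMap = B.domain) :
    ∃ B₀ B₁ : H →L[ℂ] H,
      B₀ ∈ scExtensions B ∧ B₁ ∈ scExtensions B ∧ IsSpecialPair B hB B₀ B₁ ∧
        (B₀, B₁) ≠ (leastScExtension B hB, greatestScExtension B hB) := by
  obtain ⟨hm, -⟩ := leastScExtension_isLeast B hB
  obtain ⟨hM, hMm⟩ := greatestScExtension_isGreatest B hB
  have hC : 0 ≤ greatestScExtension B hB - leastScExtension B hB := sub_nonneg.2 (hMm hm)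
  set Bm := leastScExtension B hB with hBm
  set BM := greatestScExtension B hB with hBM
  let S := CFC.sqrt (BM - Bm)
  have hS : adjoint S = S := IsSelfAdjoint.of_nonneg (CFC.sqrt_nonneg _)
  have hSS : ∀ x, S (S x) = BM x - Bm x := fun x =>
    DFunLike.congr_fun (CFC.sqrt_mul_sqrt_self (BM - Bm) hC) x
  have hdom : ∀ x, x ∈ B.domain ↔ S x = 0 := fun x => by
    rw [← hker, LinearMap.mem_ker]
    change BM x - Bm x = 0 ↔ _
    rw [← hSS]
    refine ⟨fun h => ?_, fun h => by rw [h, map_zero]⟩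
    have := adjoint_apply_eq_zero_of_self_comp_adjoint (T := S) (x := x) (by rwa [hS])
    rwa [hS] at this
  -- As a kernel, dom B is closed, so Nᗮ = dom B and "modulo Nᗮ" becomes "modulo ker S".
  have hclosed : IsClosed (B.domain : Set H) := by
    rw [← hker]
    exact (BM - Bm).isClosed_ker
  have : CompleteSpace B.domain := hclosed.completeSpace_coe
  have hNN : B.domainᗮᗮ = B.domain := Submodule.orthogonal_orthogonal _
  obtain ⟨P, Q, G, hsum, hQP, hQG, hQinj, p, hp⟩ := exists_resolution B.domainᗮ hdim
  rw [hNN] at hQP hQG hp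
  let X := (S ∘L P) ∘L adjoint (S ∘L P)
  let Y := (S ∘L Q) ∘L adjoint (S ∘L Q)
  let Z := (S ∘L G) ∘L adjoint (S ∘L G)
  have hXYZ : X + Y + Z = BM - Bm := by
    ext x
    have := DFunLike.congr_fun hsum (S x)
    change P (adjoint P (S x)) + Q (adjoint Q (S x)) + G (adjoint G (S x)) = S x at this
    have h2 := congrArg S this
    rw [map_add, map_add, hSS] at h2
    simpa [X, Y, Z, ContinuousLinearMap.adjoint_comp, hS] using h2
  have hX : 0 ≤ X := (ContinuousLinearMap.nonneg_iff_isPositive _).2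
    (ContinuousLinearMap.isPositive_self_comp_adjoint _)
  have hY : 0 ≤ Y := (ContinuousLinearMap.nonneg_iff_isPositive _).2
    (ContinuousLinearMap.isPositive_self_comp_adjoint _)
  have hZ : 0 ≤ Z := (ContinuousLinearMap.nonneg_iff_isPositive _).2
    (ContinuousLinearMap.isPositive_self_comp_adjoint _)
  have hB1 : BM - Z = Bm + X + Y := by
    rw [sub_eq_iff_eq_add, add_assoc, add_assoc, ← add_assoc X, hXYZ]; abel
  have hB10 : BM - Z - (Bm + X) = Y := by rw [hB1]; abel
  have hX0 : ∀ x ∈ B.domain, X x = 0 := fun x hx => by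
    simp [X, ContinuousLinearMap.adjoint_comp, hS, (hdom x).1 hx]
  have hZ0 : ∀ x ∈ B.domain, Z x = 0 := fun x hx => by
    simp [Z, ContinuousLinearMap.adjoint_comp, hS, (hdom x).1 hx]
  have hY0 : ∀ x, Y x = 0 ↔ x ∈ B.domain := fun x => by
    rw [hdom]
    refine ⟨fun h => hQinj _ ?_, fun h => by simp [Y, ContinuousLinearMap.adjoint_comp, hS, h]⟩
    have := adjoint_apply_eq_zero_of_self_comp_adjoint (T := S ∘L Q) h
    rwa [ContinuousLinearMap.adjoint_comp, hS] at this
  refine ⟨Bm + X, BM - Z, ?_, ?_, ⟨?_, ?_, ?_, ?_⟩, ?_⟩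
  · refine mem_scExtensions_of_mem_Icc hm hM (hm.1.add (.of_nonneg hX)) (le_add_of_nonneg_right hX)
      ?_ fun f => ?_
    · calc Bm + X ≤ Bm + X + Y := le_add_of_nonneg_right hY
        _ = BM - Z := hB1.symm
        _ ≤ BM := sub_le_self _ hZ
    · rw [add_apply, hX0 f f.2, add_zero, hm.2.2]
  · refine mem_scExtensions_of_mem_Icc hm hM (hM.1.sub (.of_nonneg hZ)) ?_ (sub_le_self _ hZ)
      fun f => ?_
    · rw [hB1, add_assoc]; exact le_add_of_nonneg_right (add_nonneg hX hY)
    · rw [sub_apply, hZ0 f f.2, sub_zero, hM.2.2]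
  · rw [← sub_nonneg, hB10]; exact hY
  · rw [hB10]; ext x; exact hY0 x
  · rw [hB10, add_sub_cancel_left, eq_bot_iff]
    rintro _ ⟨⟨u, rfl⟩, v, hv⟩
    obtain ⟨x, hx⟩ := exists_apply_eq_sqrt_self_comp_adjoint (S ∘L Q) u
    obtain ⟨y, hy⟩ := exists_apply_eq_sqrt_self_comp_adjoint (S ∘L P) v
    have h : S (Q x) = S (P y) := hx.trans (hv.symm.trans hy.symm)
    have h0 := hQP x y ((hdom _).2 (by rw [map_sub, h, sub_self]))
    rw [Submodule.mem_bot, ← hv]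
    refine hy.symm.trans ?_
    change S (P y) = 0
    rw [h0, map_zero]
  · rw [hB10, sub_sub_cancel, eq_bot_iff]
    rintro _ ⟨⟨u, rfl⟩, v, hv⟩
    obtain ⟨x, hx⟩ := exists_apply_eq_sqrt_self_comp_adjoint (S ∘L Q) u
    obtain ⟨y, hy⟩ := exists_apply_eq_sqrt_self_comp_adjoint (S ∘L G) v
    have h : S (Q x) = S (G y) := hx.trans (hv.symm.trans hy.symm)
    have h0 := hQG x y ((hdom _).2 (by rw [map_sub, h, sub_self]))
    rw [Submodule.mem_bot, ← hv]
    refine hy.symm.trans ?_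
    change S (G y) = 0
    rw [h0, map_zero]
  · intro h
    -- X = 0 forces (SP)† = 0, hence SP = 0, contrary to P p ∉ ker S.
    have hX' : X = 0 := by simpa using (Prod.ext_iff.1 h).1
    refine hp ((hdom _).2 ?_)
    have h1 : ∀ x, adjoint (S ∘L P) x = 0 := fun x =>
      adjoint_apply_eq_zero_of_self_comp_adjoint (DFunLike.congr_fun hX' x)
    refine ext_inner_right ℂ fun x => ?_
    change ⟪(S ∘L P) p, x⟫_ℂ = _
    rw [← ContinuousLinearMap.adjoint_inner_right, h1, inner_zero_left, inner_zero_right]
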